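/- An \emph{Odd-fair parity game} $\mathcal G^\ell$ consists of a finite directed graph $(V,E)$ in which every vertex has at least one outgoing edge, a partition $V=V_{\mathsf{Even}}\sqcup V_{\mathsf{Odd}}$, a priority function $\chi:V\to\mathbb N^+$, and a set $E^\ell\subseteq E$ of \emph{live edges} leaving vertices of $V_{\mathsf{Odd}}$. A play is an infinite path. It is winning for $\mathsf{Odd}$ iff (i) for every $(v,w)\in E^\ell$, if the play visits $v$ infinitely often then it takes the edge $(v,w)$ infinitely often, and (ii) the largest priority of a vertex visited infinitely often is odd; otherwise it is winning for $\mathsf{Even}$. The winning region $\mathcal W_{\mathsf{Odd}}$ is the set of vertices $v$ such that $\mathsf{Odd}$ has a (history-dependent) strategy for which all compliant plays from $v$ are winning for $\mathsf{Odd}$. For $v\in V$ let $E(v)$ and $E^\ell(v)$ be its sets of successors along edges and along live edges. For $S,T\subseteq V$ put $$\mathsf{Cpre}_{\mathsf{Odd}}(S)=\{v\in V_{\mathsf{Odd}}: E(v)\cap S\neq\emptyset\}\cup\{v\in V_{\mathsf{Even}}: E(v)\subseteq S\},$$ $$\mathsf{Npre}(S,T)=\mathsf{Cpre}_{\mathsf{Odd}}(T)\cap\bigl(V_{\mathsf{Even}}\cup\{v\in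 V_{\mathsf{Odd}}:E^\ell(v)\subseteq T\}\cup\{v\in V_{\mathsf{Odd}}:E(v)\cap S\ne\emptyset\}\bigr),$$ and $C_i=\{v\in V:\chi(v)=i\}$, $\overline{C_i}=V\setminus C_i$. An even number $l$ is the \emph{least even upper bound} of $\mathcal G^\ell$ if $C_l\cup C_{l-1}\neq\emptyset$ and $C_i=\emptyset$ for all $i>l$. \textbf{Proposition.} Let $\mathcal G^\ell$ be an Odd-fair parity game with least even upper bound $l$. Then $\mathcal W_{\mathsf{Odd}}=Z$, where $$Z=\mu Y_l.\,\nu X_{l-1}.\,\ldots\,\mu Y_2.\,\nu X_1.\ \bigcap_{j\in\{2,4,\dots,l\}}\mathcal B_j[Y_j,X_{j-1}],$$ $$\mathcal B_j[Y,X]=\Bigl(\bigcup_{i=j+1}^{l}C_i\Bigr)\cup\bigl(\overline{C_j}\cap\mathsf{Npre}(Y,X)\bigr)\cup\bigl(C_j\cap\mathsf{Cpre}_{\mathsf{Odd}}(Y)\bigr),$$ and $\mu$, $\nu$ denote least and greatest fixpoints in the lattice of subsets of $V$. Further, for fixed $l$, computing $\mathcal W_{\mathsf{Odd}}$ by evaluating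 this formula through nested fixpoint iteration (each $\mu$-variable starting from $\emptyset$, each $\nu$-variable from $V$, inner iterations being restarted after every update of an outer variable) takes $\mathcal O(n^{l+1})$ symbolic steps, where $n=|V|$ and a symbolic step is an access to a set, a union or intersection, an application of a one-step predecessor operator, or a comparison of two sets. -/

import Mathlib

universe u

namespace OddFair

/-- The two players of a parity game. -/
inductive Player
  | even
  | odd

/-- The opponent of a player. -/
def Player.opp : Player → Player
  | .even => .odd
  | .odd => .even

/-- An Odd-fair parity game on the vertex set `V` (finiteness of `V` is a hypothesis of the
theorem): a directed graph without dead ends, whose vertices are partitioned between the two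
players, with positive priorities `χ` and with live edges, which are edges leaving Odd's
vertices. -/
structure Game (V : Type u) where
  VEven : Set V
  VOdd : Set V
  partition : IsCompl VEven VOdd
  E : V → V → Prop
  no_dead_end : ∀ v, ∃ w, E v w
  χ : V → ℕ
  χ_pos : ∀ v, 0 < χ v
  /-- The live edges. -/
  El : V → V → Prop
  El_sub : ∀ v w, El v w → E v w
  El_odd : ∀ v w, El v w → v ∈ VOdd

namespace Game

variable {V : Type u}

/-- The vertices owned by a player. -/
def owned (G : Game V) : Player → Set V
  | .even => G.VEven
  | .odd => G.VOdd

/-- The vertices of priority `i`. -/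
def C (G : Game V) (i : ℕ) : Set V := {v | G.χ v = i}

/-- `l` is the least even upper bound on the priorities of `G`. As priorities are positive,
`C 0` is empty, so this forces `2 ≤ l` and a nonempty vertex set. -/
def IsLeastEvenUpperBound (G : Game V) (l : ℕ) : Prop :=
  Even l ∧ (G.C l ∪ G.C (l - 1)).Nonempty ∧ ∀ i, l < i → G.C i = ∅

/-! ### Plays, strategies, winning regions -/

/-- Plays are infinite paths. -/
def IsPlay (G : Game V) (π : ℕ → V) : Prop := ∀ i, G.E (π i) (π (i + 1))

/-- The strong transition fairness constraint: for each live edge `(v, w)`, if `v` is visited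
infinitely often, then the edge `(v, w)` is taken infinitely often. -/
def IsFair (G : Game V) (π : ℕ → V) : Prop :=
  ∀ v w, G.El v w → (∃ᶠ i in Filter.atTop, π i = v) →
    ∃ᶠ i in Filter.atTop, π i = v ∧ π (i + 1) = w

/-- The priorities of the vertices visited infinitely often. -/
def infPriorities (G : Game V) (π : ℕ → V) : Set ℕ :=
  G.χ '' {v | ∃ᶠ i in Filter.atTop, π i = v}

/-- The winning condition of each player on plays. -/
def WinsPlay (G : Game V) : Player → (ℕ → V) → Prop
  | .odd, π => G.IsFair π ∧ ∃ m, IsGreatest (G.infPriorities π) m ∧ Odd m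
  | .even, π => ¬ G.IsFair π ∨ ∃ m, IsGreatest (G.infPriorities π) m ∧ Even m

/-- A strategy of player `p`: `next u v` is the successor chosen at the vertex `v` of `p`
after the history `u` (the vertices visited before `v`, in order). -/
structure Strategy (G : Game V) (p : Player) where
  next : List V → G.owned p → V
  legal : ∀ (u : List V) (v : G.owned p), G.E v (next u v)

/-- The play `π` is compliant with the strategy `ρ`. -/
def Compliant {G : Game V} {p : Player} (ρ : G.Strategy p) (π : ℕ → V) : Prop :=
  ∀ (i : ℕ) (h : π i ∈ G.owned p), π (i + 1) = ρ.next ((List.range i).map π) ⟨π i, h⟩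

/-- The winning region of player `p`. -/
def winningRegion (G : Game V) (p : Player) : Set V :=
  {v | ∃ ρ : G.Strategy p, ∀ π, G.IsPlay π → π 0 = v → Compliant ρ π → G.WinsPlay p π}

/-! ### Set transformers -/

/-- Vertices of `p` with some successor in `S`. -/
def preE (G : Game V) (p : Player) (S : Set V) : Set V :=
  {v | v ∈ G.owned p ∧ ∃ w, G.E v w ∧ w ∈ S}

/-- Vertices of `p` with all successors in `S`. -/
def preA (G : Game V) (p : Player) (S : Set V) : Set V :=
  {v | v ∈ G.owned p ∧ ∀ w, G.E v w → w ∈ S}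

/-- Odd vertices with all successors along live edges in `S`. -/
def lpreA (G : Game V) (S : Set V) : Set V :=
  {v | v ∈ G.VOdd ∧ ∀ w, G.El v w → w ∈ S}

/-- The controllable predecessor operator of player `p`. -/
def cpre (G : Game V) (p : Player) (S : Set V) : Set V := G.preE p S ∪ G.preA p.opp S

/-- The operator `Npre(S, T)`. -/
def npre (G : Game V) (S T : Set V) : Set V :=
  G.cpre .odd T ∩ (G.VEven ∪ G.lpreA T ∪ G.preE .odd S)

theorem preE_mono (G : Game V) (p : Player) : Monotone (G.preE p) :=
  fun _ _ h _ ⟨hv, w, hw, hS⟩ => ⟨hv, w, hw, h hS⟩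

theorem preA_mono (G : Game V) (p : Player) : Monotone (G.preA p) :=
  fun _ _ h _ ⟨hv, hw⟩ => ⟨hv, fun w hE => h (hw w hE)⟩

theorem lpreA_mono (G : Game V) : Monotone G.lpreA :=
  fun _ _ h _ ⟨hv, hw⟩ => ⟨hv, fun w hE => h (hw w hE)⟩

end Game

/-! ### The μ-calculus -/

/-- Formulas of the μ-calculus over sets of vertices of `V`, with variables indexed by `ℕ` and
with the predecessor operators of a game as primitive set transformers. -/
inductive Formula (V : Type u) : Type u
  | var (i : ℕ)
  | const (S : Set V)
  | union (φ ψ : Formula V)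
  | inter (φ ψ : Formula V)
  | preE (p : Player) (φ : Formula V)
  | preA (p : Player) (φ : Formula V)
  | lpreA (φ : Formula V)
  | mu (i : ℕ) (φ : Formula V)
  | nu (i : ℕ) (φ : Formula V)

namespace Formula

variable {V : Type u}

/-- The standard semantics of a formula as a monotone function of the values of its variables;
`mu` and `nu` are the least and the greatest fixpoint. -/
def sem (G : Game V) : Formula V → ((ℕ → Set V) →o Set V)
  | var i => ⟨fun e => e i, fun _ _ h => h i⟩
  | const S => ⟨fun _ => S, fun _ _ _ => le_rfl⟩
  | union φ ψ => ⟨fun e => sem G φ e ∪ sem G ψ e,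
      fun _ _ h => Set.union_subset_union ((sem G φ).mono h) ((sem G ψ).mono h)⟩
  | inter φ ψ => ⟨fun e => sem G φ e ∩ sem G ψ e,
      fun _ _ h => Set.inter_subset_inter ((sem G φ).mono h) ((sem G ψ).mono h)⟩
  | preE p φ => ⟨fun e => G.preE p (sem G φ e),
      fun _ _ h => G.preE_mono p ((sem G φ).mono h)⟩
  | preA p φ => ⟨fun e => G.preA p (sem G φ e),
      fun _ _ h => G.preA_mono p ((sem G φ).mono h)⟩
  | lpreA φ => ⟨fun e => G.lpreA (sem G φ e),
      fun _ _ h => G.lpreA_mono ((sem G φ).mono h)⟩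
  | mu i φ => ⟨fun e => OrderHom.lfp ⟨fun S => sem G φ (Function.update e i S),
        fun _ _ h => (sem G φ).mono (Function.update_mono h)⟩,
      fun _ _ h => OrderHom.lfp.mono fun _ =>
        (sem G φ).mono (update_le_update_iff.2 ⟨le_rfl, fun j _ => h j⟩)⟩
  | nu i φ => ⟨fun e => OrderHom.gfp ⟨fun S => sem G φ (Function.update e i S),
        fun _ _ h => (sem G φ).mono (Function.update_mono h)⟩,
      fun _ _ h => OrderHom.gfp.mono fun _ =>
        (sem G φ).mono (update_le_update_iff.2 ⟨le_rfl, fun j _ => h j⟩)⟩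

/-- Fixpoint iteration from `S₀`: the transformer `F`, which returns a set and the number of
symbolic steps spent on computing it, is applied repeatedly until the set no longer changes.
With `N` the first index at which the iterates saturate, the result is the `N`-th iterate;
`N + 1` applications of `F` were carried out, each followed by one comparison of sets. -/
noncomputable def saturate (F : Set V → Set V × ℕ) (S₀ : Set V) : Set V × ℕ :=
  let s : ℕ → Set V := fun k => (fun S => (F S).1)^[k] S₀
  let N : ℕ := sInf {k | s (k + 1) = s k}
  (s N, ∑ k ∈ Finset.range (N + 1), ((F (s k)).2 + 1))

/-- The symbolic algorithm that evaluates a formula by nested fixpoint iteration, starting least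
fixpoints from the empty set and greatest fixpoints from the set of all vertices, and restarting
inner iterations whenever an outer variable has been updated. It returns the computed set and the
number of symbolic steps: one step for each access to a set, each set operation, each application
of a predecessor operator and each comparison of sets. -/
noncomputable def run (G : Game V) : Formula V → (ℕ → Set V) → Set V × ℕ
  | var i, e => (e i, 1)
  | const S, _ => (S, 1)
  | union φ ψ, e => ((run G φ e).1 ∪ (run G ψ e).1, (run G φ e).2 + (run G ψ e).2 + 1)
  | inter φ ψ, e => ((run G φ e).1 ∩ (run G ψ e).1, (run G φ e).2 + (run G ψ e).2 + 1)
  | preE p φ, e => (G.preE p (run G φ e).1, (run G φ e).2 + 1)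
  | preA p φ, e => (G.preA p (run G φ e).1, (run G φ e).2 + 1)
  | lpreA φ, e => (G.lpreA (run G φ e).1, (run G φ e).2 + 1)
  | mu i φ, e => saturate (fun S => run G φ (Function.update e i S)) ∅
  | nu i φ, e => saturate (fun S => run G φ (Function.update e i S)) Set.univ

/-- `Cpre_p` as a derived operator on formulas. -/
def cpre (p : Player) (φ : Formula V) : Formula V := union (preE p φ) (preA p.opp φ)

/-- `Npre` as a derived operator on formulas. -/
def npre (G : Game V) (φ ψ : Formula V) : Formula V :=
  inter (cpre .odd ψ) (union (union (const G.VEven) (lpreA ψ)) (preE .odd φ))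

theorem sem_cpre (G : Game V) (p : Player) (φ : Formula V) (e : ℕ → Set V) :
    sem G (cpre p φ) e = G.cpre p (sem G φ e) := rfl

theorem sem_npre (G : Game V) (φ ψ : Formula V) (e : ℕ → Set V) :
    sem G (npre G φ ψ) e = G.npre (sem G φ e) (sem G ψ e) := rfl

/-- Finite unions of formulas. -/
def bigUnion (L : List (Formula V)) : Formula V := L.foldr union (const ∅)

/-- Finite intersections of formulas. -/
def bigInter (L : List (Formula V)) : Formula V := L.foldr inter (const Set.univ)

/-- `B_j[Y, X] = (⋃_{i ∈ [j+1,l]} C_i) ∪ (V \ C_j ∩ Npre(Y, X)) ∪ (C_j ∩ Cpre_Odd(Y))`. -/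
def B (G : Game V) (l j : ℕ) (Y X : Formula V) : Formula V :=
  union
    (union (bigUnion (((List.range (l + 1)).filter (fun i => j + 1 ≤ i)).map
        (fun i => const (G.C i))))
      (inter (const (G.C j)ᶜ) (npre G Y X)))
    (inter (const (G.C j)) (cpre .odd Y))

/-- The intersection of the `B_j[Y_j, X_{j-1}]` over the even `j ∈ [2,l]`. The variable with
index `i` is called `Y_i` if `i` is even and `X_i` if `i` is odd. -/
def body (G : Game V) (l : ℕ) : Formula V :=
  bigInter (((List.range (l + 1)).filter (fun j => 2 ≤ j ∧ Even j)).map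
    (fun j => B G l j (var j) (var (j - 1))))

/-- `close φ k` binds the variables `k, k-1, …, 1` of `φ`, the variable `k` outermost: the even
ones by `mu`, the odd ones by `nu`. -/
def close (φ : Formula V) : ℕ → Formula V
  | 0 => φ
  | k + 1 => if Even (k + 1) then mu (k + 1) (close φ k) else nu (k + 1) (close φ k)

/-- `μ Y_l. ν X_{l-1}. … μ Y_2. ν X_1. ⋂_{j ∈ {2,4,…,l}} B_j[Y_j, X_{j-1}]`. -/
def oddFormula (G : Game V) (l : ℕ) : Formula V := close (body G l) l

end Formula

/-- The set `Z` denoted by the nested fixpoint formula. The formula is closed, so the values of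
the variables do not matter. -/
def Z {V : Type u} (G : Game V) (l : ℕ) : Set V := (Formula.oddFormula G l).sem G (fun _ => ∅)

end OddFair

namespace OddFair

/-! ### Chains of sets in a finite type -/

/-! Membership in a nested fixpoint is certified by ranks (`exists_signature`). Unfolding the matrix
at `v`, a variable bound by a least fixpoint may be restricted to vertices of smaller rank, and one
bound by a greatest fixpoint to vertices whose rank at the next index is not larger. A lower index
refines a higher one lexicographically. The complement of `Z` is a nested fixpoint with μ and ν
exchanged, so it carries ranks too, and each player reads a strategy off the ranks.

Outside `Z`, some `B_j` fails at each vertex `v`; call this even index `J v`. No move raises the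
rank at `J v + 1`, and if the priority is below `J v`, then the rank at `J v - 1` drops on Even's
move, on all of Odd's moves, or on a live edge. If Odd won a play, its top recurring priority would
be odd, hence below the largest recurring `J`, say `J u`. Where the rank at `J u - 1` is minimal
among recurring vertices, `J` cannot equal `J u`: fairness would make a vertex of smaller rank
recur. A smaller `J` does not raise this rank, so the play stays at the minimum and never meets `u`
again, a contradiction (`winningRegion_odd_subset_Z`).

On `Z`, Odd has at each of its vertices `v` a best successor `b v`, which makes strict progress up
to an even index `d v`; at the higher even indices above the priority of `v`, live edges do no harm.
Odd plays `b v`, except that it plays the next live edge in turn if a priority above `d v` was seen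
since the last visit to `v`. Let `m` be the top recurring priority. For even `j ≥ m` the rank at `j`
eventually never rises, so priority `j`, or `d v = j` at Odd's vertices, cannot recur. Hence `m` is
odd and `d v < m` at each recurring vertex of Odd with live edges, so its live edges are all taken
infinitely often (`Z_subset_winningRegion_odd`).

The cost bound holds because each fixpoint stabilises within `Nat.card V` rounds and the matrix
costs a constant depending on `l` only. -/

theorem exists_stable_of_chain {V : Type u} [Finite V] (s : ℕ → Set V)
    (h : ∀ k, s k ⊆ s (k + 1)) : ∃ k ≤ Nat.card V, s (k + 1) = s k := by
  by_contra! hc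
  have hlt : ∀ k ≤ Nat.card V + 1, k ≤ (s k).ncard := by
    intro k
    induction k with
    | zero => simp
    | succ k ih =>
      intro hk
      have h1 := ih (by omega)
      have h2 : (s k).ncard < (s (k + 1)).ncard :=
        Set.ncard_lt_ncard ((h k).ssubset_of_ne (hc k (by omega)).symm) (Set.toFinite _)
      omega
  have h1 := hlt _ le_rfl
  have h2 : (s (Nat.card V + 1)).ncard ≤ Nat.card V := Set.ncard_le_card _
  omega

theorem exists_stable_of_antitone_chain {V : Type u} [Finite V] (s : ℕ → Set V)
    (h : ∀ k, s (k + 1) ⊆ s k) : ∃ k ≤ Nat.card V, s (k + 1) = s k := by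
  obtain ⟨k, hk, he⟩ := exists_stable_of_chain (fun k => (s k)ᶜ)
    fun k => Set.compl_subset_compl.2 (h k)
  exact ⟨k, hk, compl_injective he⟩

/-! ### Signatures for nested fixpoints -/

/-- Membership in a nested fixpoint is witnessed by ranks: `ρ i` measures the progress of the
least fixpoints binding the variables with index at least `i`, lexicographically. Here `N k` is
the semantics of the formula with the variables `1, …, k` bound, and `p i` says that the variable
`i` is bound by a least fixpoint. -/
theorem exists_signature {V : Type u} [Finite V] (p : ℕ → Prop) [DecidablePred p]
    (N : ℕ → (ℕ → Set V) → Set V) (mono : ∀ k, Monotone (N k))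
    (hμ : ∀ k e S, p (k + 1) → N k (Function.update e (k + 1) S) ⊆ S → N (k + 1) e ⊆ S)
    (hfix : ∀ k e, N k (Function.update e (k + 1) (N (k + 1) e)) = N (k + 1) e)
    (k : ℕ) : ∀ e, ∃ ρ : ℕ → V → ℕ,
      (∃ M, ∀ i v, ρ i v ≤ M) ∧
      (∀ i v w, ρ (i + 1) v < ρ (i + 1) w → ρ i v < ρ i w) ∧
      (∀ i v, k < i → ρ i v = 0) ∧
      ∀ v ∈ N k e, v ∈ N 0 (fun i => if k < i ∨ i = 0 then e i else
        if p i then {w | w ∈ N k e ∧ ρ i w < ρ i v}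
        else {w | w ∈ N k e ∧ ρ (i + 1) w ≤ ρ (i + 1) v}) := by
  induction k with
  | zero =>
    intro e
    refine ⟨fun _ _ => 0, ⟨0, by simp⟩, by simp, by simp, fun v hv => ?_⟩
    have : ∀ i : ℕ, 0 < i ∨ i = 0 := fun i => by omega
    simpa [this] using hv
  | succ k ih =>
    intro e
    by_cases hp : p (k + 1)
    · choose ρ hρ using ih
      choose M hM using fun e => (hρ e).1
      have href := fun e => (hρ e).2.1
      have hmem := fun e => (hρ e).2.2.2
      let s : ℕ → Set V := fun n => (fun S => N k (Function.update e (k + 1) S))^[n] ∅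
      have hs : ∀ n, s (n + 1) = N k (Function.update e (k + 1) (s n)) := fun n =>
        Function.iterate_succ_apply' _ _ _
      have hmono : ∀ n, s n ⊆ s (n + 1) := by
        intro n
        induction n with
        | zero => exact Set.empty_subset _
        | succ n ihn => rw [hs, hs (n + 1)]; exact mono k (Function.update_mono ihn)
      have hle : Monotone s := monotone_nat_of_le_succ hmono
      have hsub : ∀ n, s n ⊆ N (k + 1) e := by
        intro n
        induction n with
        | zero => exact Set.empty_subset _
        | succ n ihn => rw [hs]; exact (mono k (Function.update_mono ihn)).trans (hfix k e).subset
      obtain ⟨n₀, -, hn₀⟩ := exists_stable_of_chain s hmono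
      have hcov : N (k + 1) e ⊆ s n₀ := hμ k e _ hp (by rw [← hs, hn₀])
      -- Shifted by one, so that `v` lies in the body evaluated at the approximant `s (r v)`; any
      -- `w` in that approximant has `r w < r v`.
      let r : V → ℕ := fun v => sInf {n | v ∈ s (n + 1)}
      have hr : ∀ v ∈ N (k + 1) e, v ∈ s (r v + 1) := fun v hv =>
        Nat.sInf_mem (s := {n | v ∈ s (n + 1)}) ⟨n₀, hmono _ (hcov hv)⟩
      have hr' : ∀ v n, v ∈ s (n + 1) → r v ≤ n := fun v n h => Nat.sInf_le h
      -- Inner ranks depend on the environment, hence on the stage `r v` alone; vertices of equal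
      -- stage share them.
      let σ : V → ℕ → V → ℕ := fun v => ρ (Function.update e (k + 1) (s (r v)))
      obtain ⟨B, hB⟩ := Finite.exists_le (fun v => M (Function.update e (k + 1) (s (r v))))
      have hσB : ∀ u i v, σ u i v ≤ B := fun u i v => (hM _ i v).trans (hB u)
      obtain ⟨R, hR⟩ := Finite.exists_le r
      have hσ : ∀ v w, r v = r w → σ v = σ w := fun v w h => by simp only [σ, h]
      -- As inner ranks are at most `B`, this number encodes the lexicographic pair of stage and
      -- inner rank.
      have hlt : ∀ v w i j, r v < r w → r v * (B + 1) + σ v i v < r w * (B + 1) + σ w j w := by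
        intro v w i j h
        have h1 := hσB v i v
        have h2 : (r v + 1) * (B + 1) ≤ r w * (B + 1) := Nat.mul_le_mul_right _ h
        nlinarith
      refine ⟨fun i v => if k + 1 < i then 0 else r v * (B + 1) + σ v i v,
        ⟨R * (B + 1) + B, fun i v => ?_⟩, fun i v w h => ?_, fun i v h => by simp [h],
        fun v hv => ?_⟩
      · dsimp only
        split_ifs
        · exact Nat.zero_le _
        · exact add_le_add (Nat.mul_le_mul_right _ (hR v)) (hσB _ _ _)
      · by_cases hi : k + 1 < i + 1
        · simp [hi] at h
        · have hi' : ¬ k + 1 < i := by omega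
          simp only [hi, hi', if_false] at h ⊢
          rcases lt_trichotomy (r v) (r w) with h1 | h1 | h1
          · exact hlt _ _ _ _ h1
          · rw [hσ v w h1, h1] at h
            rw [hσ v w h1, h1]
            exact Nat.add_lt_add_left (href _ i v w (Nat.lt_of_add_lt_add_left h)) _
          · exact absurd h (hlt _ _ _ _ h1).le.not_gt
      · have h1 : v ∈ N k (Function.update e (k + 1) (s (r v))) := hs _ ▸ hr v hv
        have h2 := hmem _ v h1
        refine mono 0 (fun i => ?_) h2
        rw [← hs]
        by_cases hi0 : i = 0
        · simp [hi0]
        by_cases hik : k + 1 < i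
        · have : k < i := by omega
          simp [this, hik, Function.update_of_ne (show i ≠ k + 1 by omega)]
        by_cases hik' : i = k + 1
        · subst hik'
          simp only [hp, Function.update_self, lt_irrefl, Nat.lt_succ_self, true_or, if_true,
            if_false, false_or, Nat.succ_ne_zero]
          intro w hw
          refine ⟨hsub _ hw, hlt _ _ _ _ ?_⟩
          rcases hrv : r v with _ | n
          · rw [hrv] at hw; exact hw.elim
          · rw [hrv] at hw; exact Nat.lt_succ_of_le (hr' w n hw)
        have hik2 : ¬ k < i := by omega
        have hik3 : ¬ k + 1 < i + 1 := by omega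
        simp only [hi0, hik, hik2, hik3, or_self, if_false]
        have key : ∀ j w, w ∈ s (r v + 1) → σ v j w ≤ σ v j v →
            r w * (B + 1) + σ w j w ≤ r v * (B + 1) + σ v j v := by
          intro j w hw h
          rcases (hr' w _ hw).lt_or_eq with h3 | h3
          · exact (hlt _ _ _ _ h3).le
          · rw [hσ w v h3, h3]; exact Nat.add_le_add_left h _
        split_ifs with hpi
        · rintro w ⟨hw, hw'⟩
          refine ⟨hsub _ hw, ?_⟩
          rcases (hr' w _ hw).lt_or_eq with h3 | h3
          · exact hlt _ _ _ _ h3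
          · rw [hσ w v h3, h3]; exact Nat.add_lt_add_left hw' _
        · rintro w ⟨hw, hw'⟩
          exact ⟨hsub _ hw, key _ _ hw hw'⟩
    -- A greatest fixpoint needs no new rank: it is unfolded once at its own value. The condition on
    -- its variable compares ranks at index `k + 2`, which vanish by `hzero`.
    · obtain ⟨ρ, hM, href, hzero, hmem⟩ := ih (Function.update e (k + 1) (N (k + 1) e))
      refine ⟨ρ, hM, href, fun i v h => hzero i v (by omega), fun v hv => ?_⟩
      have h2 := hmem v ((hfix k e).symm ▸ hv)
      rw [hfix] at h2
      refine mono 0 (fun i => ?_) h2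
      by_cases hi0 : i = 0
      · simp [hi0]
      by_cases hik : k + 1 < i
      · have : k < i := by omega
        simp [this, hik, Function.update_of_ne (show i ≠ k + 1 by omega)]
      by_cases hik' : i = k + 1
      · subst hik'
        simp [hp, hzero]
      have hik2 : ¬ k < i := by omega
      simp [hi0, hik, hik2]

end OddFair

namespace OddFair

/-! ### Correctness and cost of nested fixpoint iteration -/

namespace Formula

variable {V : Type u}

theorem exists_saturate_eq (F : Set V → Set V × ℕ) (S₀ : Set V) (m : ℕ)
    (h : ∃ k ≤ m, (fun S => (F S).1)^[k + 1] S₀ = (fun S => (F S).1)^[k] S₀) :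
    ∃ N ≤ m, (saturate F S₀).1 = (fun S => (F S).1)^[N] S₀ ∧
      (F (saturate F S₀).1).1 = (saturate F S₀).1 ∧
      ∀ D, (∀ S, (F S).2 ≤ D) → (saturate F S₀).2 ≤ (m + 1) * (D + 1) := by
  obtain ⟨k, hk, he⟩ := h
  let T : Set ℕ := {k | (fun S => (F S).1)^[k + 1] S₀ = (fun S => (F S).1)^[k] S₀}
  have hN : sInf T ≤ m := (Nat.sInf_le (s := T) he).trans hk
  have hT : sInf T ∈ T := Nat.sInf_mem ⟨k, he⟩
  refine ⟨sInf T, hN, rfl, ?_, fun D hD => ?_⟩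
  · have := hT
    simp only [T, Set.mem_ofPred_eq] at this
    rw [Function.iterate_succ_apply'] at this
    exact this
  · change ∑ k ∈ Finset.range (sInf T + 1), ((F ((fun S => (F S).1)^[k] S₀)).2 + 1) ≤ _
    calc _ ≤ ∑ _k ∈ Finset.range (sInf T + 1), (D + 1) :=
          Finset.sum_le_sum fun k _ => Nat.add_le_add_right (hD _) 1
      _ = (sInf T + 1) * (D + 1) := by simp
      _ ≤ _ := Nat.mul_le_mul_right _ (by omega)

/-- Every iterate from `∅` stays below the least fixpoint, and the increasing chain stops within
`Nat.card V` steps, at a fixpoint. One further application detects the stop. -/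
theorem saturate_empty [Finite V] (F : Set V → Set V × ℕ) (f : Set V →o Set V)
    (hf : ∀ S, (F S).1 = f S) :
    (saturate F ∅).1 = OrderHom.lfp f ∧
      ∀ D, (∀ S, (F S).2 ≤ D) → (saturate F ∅).2 ≤ (Nat.card V + 1) * (D + 1) := by
  have hF : (fun S => (F S).1) = f := funext hf
  have hs : ∀ n, f^[n] ∅ ⊆ f^[n + 1] ∅ := fun n => by
    induction n with
    | zero => exact Set.empty_subset _
    | succ n ih => rw [Function.iterate_succ_apply', Function.iterate_succ_apply']; exact f.mono ih
  have hle : ∀ n, f^[n] ∅ ⊆ OrderHom.lfp f := fun n => by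
    induction n with
    | zero => exact Set.empty_subset _
    | succ n ih => rw [Function.iterate_succ_apply', ← f.map_lfp]; exact f.mono ih
  obtain ⟨N, -, h1, h2, h3⟩ := exists_saturate_eq F ∅ (Nat.card V) (by
    rw [hF]; exact exists_stable_of_chain _ hs)
  refine ⟨subset_antisymm ?_ (OrderHom.lfp_le _ ?_), h3⟩
  · rw [h1, hF]; exact hle N
  · rw [hf] at h2; exact h2.le

theorem saturate_univ [Finite V] (F : Set V → Set V × ℕ) (f : Set V →o Set V)
    (hf : ∀ S, (F S).1 = f S) :
    (saturate F Set.univ).1 = OrderHom.gfp f ∧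
      ∀ D, (∀ S, (F S).2 ≤ D) → (saturate F Set.univ).2 ≤ (Nat.card V + 1) * (D + 1) := by
  have hF : (fun S => (F S).1) = f := funext hf
  have hs : ∀ n, f^[n + 1] Set.univ ⊆ f^[n] Set.univ := fun n => by
    induction n with
    | zero => exact Set.subset_univ _
    | succ n ih =>
      rw [Function.iterate_succ_apply' f (n + 1)]
      exact (f.mono ih).trans (Function.iterate_succ_apply' f n Set.univ).ge
  have hle : ∀ n, OrderHom.gfp f ⊆ f^[n] Set.univ := fun n => by
    induction n with
    | zero => exact Set.subset_univ _
    | succ n ih => rw [Function.iterate_succ_apply', ← f.map_gfp]; exact f.mono ih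
  obtain ⟨N, -, h1, h2, h3⟩ := exists_saturate_eq F Set.univ (Nat.card V) (by
    rw [hF]; exact exists_stable_of_antitone_chain (fun n => f^[n] Set.univ) hs)
  refine ⟨subset_antisymm (OrderHom.le_gfp _ ?_) ?_, h3⟩
  · rw [hf] at h2; exact h2.ge
  · rw [h1, hF]; exact hle N

/-- Nested fixpoint iteration computes the semantics of a formula. -/
theorem run_fst [Finite V] (G : Game V) (φ : Formula V) :
    ∀ e, (run G φ e).1 = sem G φ e := by
  induction φ with
  | var i => intro e; rfl
  | const S => intro e; rfl
  | union φ ψ h1 h2 => intro e; simp only [run, h1, h2]; rfl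
  | inter φ ψ h1 h2 => intro e; simp only [run, h1, h2]; rfl
  | preE p φ h => intro e; simp only [run, h]; rfl
  | preA p φ h => intro e; simp only [run, h]; rfl
  | lpreA φ h => intro e; simp only [run, h]; rfl
  | mu i φ h => intro e; exact (saturate_empty _ _ fun S => h _).1
  | nu i φ h => intro e; exact (saturate_univ _ _ fun S => h _).1

theorem run_snd_close_succ_le [Finite V] (G : Game V) (φ : Formula V) (k D : ℕ)
    (hD : ∀ e, (run G (close φ k) e).2 ≤ D) (e : ℕ → Set V) :
    (run G (close φ (k + 1)) e).2 ≤ (Nat.card V + 1) * (D + 1) := by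
  have hmono : Monotone fun S => sem G (close φ k) (Function.update e (k + 1) S) :=
    fun _ _ h => (sem G _).mono (Function.update_mono h)
  rw [close]
  split_ifs
  · exact (saturate_empty (fun S => run G (close φ k) (Function.update e (k + 1) S))
      ⟨_, hmono⟩ fun S => run_fst G _ _).2 D fun S => hD _
  · exact (saturate_univ (fun S => run G (close φ k) (Function.update e (k + 1) S))
      ⟨_, hmono⟩ fun S => run_fst G _ _).2 D fun S => hD _

/-- Each binder multiplies the cost by at most a constant times the number of vertices; `c` depends
on `D` and `k` only, uniformly in the game. -/
theorem run_snd_close_le (D k : ℕ) : ∃ c : ℕ, ∀ (V : Type u) [Finite V] [Nonempty V] (G : Game V)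
    (φ : Formula V), (∀ e, (run G φ e).2 ≤ D) →
    ∀ e, (run G (close φ k) e).2 ≤ c * Nat.card V ^ k := by
  induction k with
  | zero => exact ⟨D, fun V _ _ G φ h e => by simpa [close] using h e⟩
  | succ k ih =>
    obtain ⟨c, hc⟩ := ih
    refine ⟨2 * (c + 1), fun V _ _ G φ h e => ?_⟩
    have hn : 1 ≤ Nat.card V := Nat.card_pos
    calc _ ≤ (Nat.card V + 1) * (c * Nat.card V ^ k + 1) :=
          run_snd_close_succ_le G φ k _ (hc V G φ h) e
      _ ≤ (2 * Nat.card V) * ((c + 1) * Nat.card V ^ k) := by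
          refine Nat.mul_le_mul (by omega) ?_
          have := Nat.one_le_pow k _ hn
          rw [add_mul]; omega
      _ = _ := by ring

theorem run_snd_bigUnion_const (G : Game V) (L : List ℕ) (e : ℕ → Set V) :
    (run G (bigUnion (L.map fun i => const (G.C i))) e).2 = 2 * L.length + 1 := by
  induction L with
  | nil => rfl
  | cons a L ih =>
    simp only [bigUnion] at ih
    simp only [bigUnion, List.map_cons, List.foldr_cons, run, ih, List.length_cons]
    omega

theorem run_snd_bigInter_le (G : Game V) (f : ℕ → Formula V) (D : ℕ) (e : ℕ → Set V)
    (hD : ∀ j, (run G (f j) e).2 ≤ D) (L : List ℕ) :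
    (run G (bigInter (L.map f)) e).2 ≤ (D + 1) * L.length + 1 := by
  induction L with
  | nil => rfl
  | cons a L ih =>
    simp only [bigInter] at ih
    have := hD a
    simp only [bigInter, List.map_cons, List.foldr_cons, run, List.length_cons, mul_add]
    omega

theorem run_snd_body_le (G : Game V) (l : ℕ) (e : ℕ → Set V) :
    (run G (body G l) e).2 ≤ (2 * (l + 1) + 40) * (l + 1) + 1 := by
  have hlen : ∀ q : ℕ → Bool, ((List.range (l + 1)).filter q).length ≤ l + 1 := fun q =>
    (List.length_filter_le _ _).trans (by simp)
  -- The union of priority classes accounts for `2 * (l + 1)`; the 39 is a generous allowance for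
  -- the rest of `B`.
  refine (run_snd_bigInter_le G _ (2 * (l + 1) + 39) e (fun j => ?_) _).trans ?_
  · have := hlen (fun i => j + 1 ≤ i)
    simp only [B, run, npre, cpre, run_snd_bigUnion_const]
    omega
  · exact Nat.add_le_add_right (Nat.mul_le_mul_left _ (hlen _)) 1

/-! ### Membership in the matrix of the formula -/

theorem mem_sem_bigUnion_const (G : Game V) (L : List ℕ) (e : ℕ → Set V) (v : V) :
    v ∈ sem G (bigUnion (L.map fun i => const (G.C i))) e ↔ G.χ v ∈ L := by
  induction L with
  | nil => exact ⟨fun h => h.elim, fun h => by simp at h⟩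
  | cons a L ih =>
    rw [List.mem_cons]
    exact or_congr Iff.rfl ih

theorem mem_sem_bigInter (G : Game V) (f : ℕ → Formula V) (L : List ℕ) (e : ℕ → Set V) (v : V) :
    v ∈ sem G (bigInter (L.map f)) e ↔ ∀ j ∈ L, v ∈ sem G (f j) e := by
  induction L with
  | nil => exact ⟨fun _ j h => by simp at h, fun _ => trivial⟩
  | cons a L ih =>
    rw [List.forall_mem_cons]
    exact and_congr Iff.rfl ih

theorem mem_sem_body (G : Game V) (l : ℕ) (e : ℕ → Set V) (v : V) :
    v ∈ sem G (body G l) e ↔ ∀ j, 2 ≤ j → j ≤ l → Even j →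
      (j < G.χ v ∧ G.χ v ≤ l) ∨ (G.χ v ≠ j ∧ v ∈ G.npre (e j) (e (j - 1))) ∨
        (G.χ v = j ∧ v ∈ G.cpre .odd (e j)) := by
  have hB : ∀ j, v ∈ sem G (B G l j (var j) (var (j - 1))) e ↔
      (j < G.χ v ∧ G.χ v ≤ l) ∨ (G.χ v ≠ j ∧ v ∈ G.npre (e j) (e (j - 1))) ∨
        (G.χ v = j ∧ v ∈ G.cpre .odd (e j)) := fun j => by
    have h1 := mem_sem_bigUnion_const G ((List.range (l + 1)).filter (fun i => j + 1 ≤ i)) e v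
    simp only [List.mem_filter, List.mem_range, decide_eq_true_eq] at h1
    rw [← or_assoc]
    refine or_congr (or_congr (h1.trans ?_) Iff.rfl) Iff.rfl
    omega
  rw [body, mem_sem_bigInter]
  simp only [List.mem_filter, List.mem_range, decide_eq_true_eq, hB]
  exact ⟨fun h j h1 h2 h3 => h j ⟨by omega, h1, h3⟩, fun h j hj => h j hj.2.1 (by omega) hj.2.2⟩

end Formula

end OddFair

namespace OddFair

/-! ### Ranks on the fixpoint set and on its complement -/

variable {V : Type u}

theorem rank_lt_of_le {r : ℕ → V → ℕ} (h : ∀ i v w, r (i + 1) v < r (i + 1) w → r i v < r i w)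
    {i j : ℕ} (hij : i ≤ j) {v w : V} : r j v < r j w → r i v < r i w := by
  induction j, hij using Nat.le_induction with
  | base => exact id
  | succ j _ ih => exact fun h' => ih (h _ _ _ h')

namespace Formula

theorem sem_close_succ_eq (G : Game V) (φ : Formula V) (k : ℕ) (e : ℕ → Set V) :
    sem G (close φ k) (Function.update e (k + 1) (sem G (close φ (k + 1)) e)) =
      sem G (close φ (k + 1)) e := by
  have hmono : Monotone fun S => sem G (close φ k) (Function.update e (k + 1) S) :=
    fun _ _ h => (sem G _).mono (Function.update_mono h)
  rw [close]
  split_ifs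
  · exact OrderHom.map_lfp ⟨_, hmono⟩
  · exact OrderHom.map_gfp ⟨_, hmono⟩

theorem sem_close_succ_subset (G : Game V) (φ : Formula V) {k : ℕ} (hk : Even (k + 1))
    {e : ℕ → Set V} {S : Set V}
    (h : sem G (close φ k) (Function.update e (k + 1) S) ⊆ S) :
    sem G (close φ (k + 1)) e ⊆ S := by
  rw [close, if_pos hk]
  exact OrderHom.lfp_le _ h

theorem subset_sem_close_succ (G : Game V) (φ : Formula V) {k : ℕ} (hk : ¬ Even (k + 1))
    {e : ℕ → Set V} {S : Set V}
    (h : S ⊆ sem G (close φ k) (Function.update e (k + 1) S)) :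
    S ⊆ sem G (close φ (k + 1)) e := by
  rw [close, if_neg hk]
  exact OrderHom.le_gfp _ h

end Formula

open Formula

/-- On `Z` all the `B_j` hold at once. The strict drop comes from the μ-variable `Y_j`, the weak one
from `X_{j-1}`, compared at index `j`. -/
theorem exists_rank_of_mem_Z [Finite V] (G : Game V) (l : ℕ) : ∃ r : ℕ → V → ℕ,
    (∀ i j v w, i ≤ j → r j v < r j w → r i v < r i w) ∧
    ∀ v ∈ Z G l, ∀ j, 2 ≤ j → j ≤ l → Even j → G.χ v ≤ j →
      (G.χ v = j → v ∈ G.cpre .odd {w | w ∈ Z G l ∧ r j w < r j v}) ∧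
      (G.χ v < j → v ∈ G.npre {w | w ∈ Z G l ∧ r j w < r j v}
        {w | w ∈ Z G l ∧ r j w ≤ r j v}) := by
  obtain ⟨r, -, h1, -, h2⟩ := exists_signature Even
    (fun k e => sem G (close (body G l) k) e) (fun k => (sem G _).mono)
    (fun k e S hk h => sem_close_succ_subset G _ hk h)
    (fun k e => sem_close_succ_eq G _ k e) l (fun _ => ∅)
  refine ⟨r, fun i j v w hij => rank_lt_of_le h1 hij, fun v hv j hj hjl hje hχ => ?_⟩
  have h3 := (mem_sem_body G l _ v).1 (h2 v hv) j hj hjl hje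
  have hj1 : ¬ (l < j ∨ j = 0) := by omega
  have hj2 : ¬ (l < j - 1 ∨ j - 1 = 0) := by omega
  have hj3 : ¬ Even (j - 1) := by
    obtain ⟨a, rfl⟩ := hje
    rintro ⟨b, hb⟩
    omega
  have hj4 : j - 1 + 1 = j := by omega
  simp only [hj1, hj2, hj3, hj4, hje, if_true, if_false] at h3
  rcases h3 with h3 | h3 | h3
  · omega
  · exact ⟨fun h => (h3.1 h).elim, fun _ => h3.2⟩
  · exact ⟨fun _ => h3.2, fun h => (h.ne h3.1).elim⟩

/-- By duality the odd variables are now the least fixpoints: `X_{j-1}` yields the strict drop at `j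
- 1`, and `Y_j` the weak one at `j + 1`. Only some `j` is obtained, since failing an intersection
means failing one member. -/
theorem exists_rank_of_notMem_Z [Finite V] (G : Game V) (l : ℕ) : ∃ r : ℕ → V → ℕ,
    (∀ i j v w, i ≤ j → r j v < r j w → r i v < r i w) ∧
    ∀ v ∉ Z G l, G.χ v ≤ l → ∃ j, 2 ≤ j ∧ j ≤ l ∧ Even j ∧ G.χ v ≤ j ∧
      (G.χ v = j → v ∉ G.cpre .odd {w | w ∉ Z G l ∧ r (j + 1) w ≤ r (j + 1) v}ᶜ) ∧
      (G.χ v < j → v ∉ G.npre {w | w ∉ Z G l ∧ r (j + 1) w ≤ r (j + 1) v}ᶜ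
        {w | w ∉ Z G l ∧ r (j - 1) w < r (j - 1) v}ᶜ) := by
  have hupd : ∀ (e : ℕ → Set V) k S, (fun i => (Function.update e k S i)ᶜ) =
      Function.update (fun i => (e i)ᶜ) k Sᶜ := fun e k S => Function.comp_update compl e k S
  obtain ⟨r, -, h1, -, h2⟩ := exists_signature (fun i => ¬ Even i)
    (fun k e => (sem G (close (body G l) k) (fun i => (e i)ᶜ))ᶜ)
    (fun k e e' h => Set.compl_subset_compl.2
      ((sem G _).mono fun i => Set.compl_subset_compl.2 (h i)))
    (fun k e S hk h => by
      rw [Set.compl_subset_comm] at h ⊢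
      rw [hupd] at h
      exact subset_sem_close_succ G _ hk h)
    (fun k e => by
      rw [hupd, compl_compl, sem_close_succ_eq]) l (fun _ => ∅ᶜ)
  simp only [compl_compl] at h2
  refine ⟨r, fun i j v w hij => rank_lt_of_le h1 hij, fun v hv hχ => ?_⟩
  have h3 := h2 v hv
  rw [Set.mem_compl_iff] at h3
  have h4 := mt (mem_sem_body G l _ v).2 h3
  push Not at h4
  obtain ⟨j, hj, hjl, hje, h5, h6, h7⟩ := h4
  have hj1 : ¬ (l < j ∨ j = 0) := by omega
  have hj2 : ¬ (l < j - 1 ∨ j - 1 = 0) := by omega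
  have hj3 : ¬ Even (j - 1) := by
    obtain ⟨a, rfl⟩ := hje
    rintro ⟨b, hb⟩
    omega
  simp only [hj1, hj2, hj3, hje, if_true, if_false, not_true, not_false_iff] at h6 h7
  exact ⟨j, hj, hjl, hje, by omega, h7, fun h => h6 h.ne⟩

/-! ### Plays on finite graphs -/

theorem eventually_frequently_eq [Finite V] (π : ℕ → V) :
    ∀ᶠ t in Filter.atTop, ∃ᶠ i in Filter.atTop, π i = π t := by
  have : ∀ᶠ t in Filter.atTop, ∀ v, ¬ (∃ᶠ i in Filter.atTop, π i = v) → π t ≠ v := by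
    refine Filter.eventually_all.2 fun v => ?_
    by_cases h : ∃ᶠ i in Filter.atTop, π i = v
    · simp [h]
    · filter_upwards [Filter.not_frequently.1 h] with t ht _ using ht
  filter_upwards [this] with t ht
  by_contra h
  exact ht _ h rfl

theorem not_frequently_lt_of_eventually_le (f : ℕ → ℕ)
    (h : ∀ᶠ t in Filter.atTop, f (t + 1) ≤ f t) :
    ¬ ∃ᶠ t in Filter.atTop, f (t + 1) < f t := by
  intro hf
  obtain ⟨T, hT⟩ := Filter.eventually_atTop.1 h
  have key : ∀ n, ∃ t ≥ T, f t + n ≤ f T := by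
    intro n
    induction n with
    | zero => exact ⟨T, le_rfl, le_rfl⟩
    | succ n ih =>
      obtain ⟨t, ht, hn⟩ := ih
      obtain ⟨t', ht', hlt⟩ := Filter.frequently_atTop.1 hf t
      have : f t' ≤ f t :=
        antitoneOn_nat_Ici_of_succ_le hT ht (le_trans ht ht') ht'
      exact ⟨t' + 1, by omega, by omega⟩
  obtain ⟨t, -, h⟩ := key (f T + 1)
  omega

theorem Game.exists_isGreatest_infPriorities [Finite V] (G : Game V) (π : ℕ → V) :
    ∃ m, IsGreatest (G.infPriorities π) m ∧ ∀ᶠ t in Filter.atTop, G.χ (π t) ≤ m := by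
  have hfin : (G.infPriorities π).Finite := (Set.toFinite _).image _
  have hne : (G.infPriorities π).Nonempty := by
    obtain ⟨t, ht⟩ := (eventually_frequently_eq π).exists
    exact ⟨_, π t, ht, rfl⟩
  obtain ⟨m, hm⟩ := hfin.bddAbove.exists_isGreatest_of_nonempty hne
  refine ⟨m, hm, ?_⟩
  filter_upwards [eventually_frequently_eq π] with t ht
  exact hm.2 ⟨π t, ht, rfl⟩

theorem Game.mem_VEven_or_mem_VOdd (G : Game V) (v : V) : v ∈ G.VEven ∨ v ∈ G.VOdd := by
  have : v ∈ G.VEven ⊔ G.VOdd := by rw [G.partition.sup_eq_top]; trivial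
  exact this

theorem Game.notMem_VOdd_of_mem_VEven (G : Game V) {v : V} (h : v ∈ G.VEven) : v ∉ G.VOdd :=
  fun h' => Set.disjoint_left.1 G.partition.disjoint h h'

end OddFair

namespace OddFair

variable {V : Type u}

/-! ### Outside the fixpoint set, Odd does not win -/

/-- The positional description of Even's strategy outside of `Z`: `r` ranks the vertices and
`J v` is the even index at which progress is measured at `v`. -/
theorem exists_even_progress [Finite V] (G : Game V) (l : ℕ) (hl : ∀ v, G.χ v ≤ l) :
    ∃ (r : ℕ → V → ℕ) (J : V → ℕ), (∀ i j v w, i ≤ j → r j v < r j w → r i v < r i w) ∧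
      ∀ v ∉ Z G l, Even (J v) ∧ G.χ v ≤ J v ∧
        (v ∈ G.VEven → ∃ w, G.E v w ∧ w ∉ Z G l ∧ r (J v + 1) w ≤ r (J v + 1) v ∧
          (G.χ v < J v → r (J v - 1) w < r (J v - 1) v)) ∧
        (v ∈ G.VOdd → (∀ w, G.E v w → w ∉ Z G l ∧ r (J v + 1) w ≤ r (J v + 1) v) ∧
          (G.χ v < J v → (∀ w, G.E v w → r (J v - 1) w < r (J v - 1) v) ∨
            ∃ w, G.El v w ∧ r (J v - 1) w < r (J v - 1) v)) := by
  obtain ⟨r, hr, h⟩ := exists_rank_of_notMem_Z G l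
  have hr' : ∀ i j v w, i ≤ j → r i v ≤ r i w → r j v ≤ r j w := fun i j v w hij h =>
    not_lt.1 fun h' => (hr i j w v hij h').not_ge h
  choose! J h using h
  refine ⟨r, J, hr, fun v hv => ?_⟩
  obtain ⟨-, -, h3, h4, h5, h6⟩ := h v hv (hl v)
  refine ⟨h3, h4, fun hE => ?_, fun hO => ?_⟩
  · rcases h4.lt_or_eq with h7 | h7
    · have h8 : v ∉ G.preA .even {w | w ∉ Z G l ∧ r (J v - 1) w < r (J v - 1) v}ᶜ :=
        fun h8 => h6 h7 ⟨Or.inr h8, Or.inl (Or.inl hE)⟩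
      have h9 : ∃ w, G.E v w ∧ w ∉ Z G l ∧ r (J v - 1) w < r (J v - 1) v := by
        by_contra! h9
        exact h8 ⟨hE, fun w hw hw' => (h9 w hw hw'.1).not_gt hw'.2⟩
      obtain ⟨w, hw, hwZ, hlt⟩ := h9
      exact ⟨w, hw, hwZ, hr' _ _ _ _ (by omega) hlt.le, fun _ => hlt⟩
    · have h9 : ∃ w, G.E v w ∧ w ∉ Z G l ∧ r (J v + 1) w ≤ r (J v + 1) v := by
        by_contra! h9
        exact h5 h7 (Or.inr ⟨hE, fun w hw hw' => (h9 w hw hw'.1).not_ge hw'.2⟩)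
      obtain ⟨w, hw, hwZ, hle⟩ := h9
      exact ⟨w, hw, hwZ, hle, fun h => (h.ne h7).elim⟩
  · rcases h4.lt_or_eq with h7 | h7
    -- If `Cpre` holds, both other clauses of `Npre` fail: some live edge makes progress and no edge
    -- raises the rank at `J v + 1`. If `Cpre` fails, all edges make progress.
    · by_cases h8 : v ∈ G.cpre .odd {w | w ∉ Z G l ∧ r (J v - 1) w < r (J v - 1) v}ᶜ
      · have h10 : ∃ w, G.El v w ∧ w ∉ Z G l ∧ r (J v - 1) w < r (J v - 1) v := by
          by_contra! h10
          exact h6 h7 ⟨h8, Or.inl (Or.inr ⟨hO, fun w hw hw' =>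
            (h10 w hw hw'.1).not_gt hw'.2⟩)⟩
        obtain ⟨w, hw, -, hlt⟩ := h10
        refine ⟨fun w' hw' => ?_, fun _ => Or.inr ⟨w, hw, hlt⟩⟩
        by_contra h11
        exact h6 h7 ⟨h8, Or.inr ⟨hO, w', hw', h11⟩⟩
      · have h9 : ∀ w, G.E v w → w ∉ Z G l ∧ r (J v - 1) w < r (J v - 1) v := by
          intro w hw
          by_contra h10
          exact h8 (Or.inl ⟨hO, w, hw, h10⟩)
        exact ⟨fun w hw => ⟨(h9 w hw).1, hr' _ _ _ _ (by omega) (h9 w hw).2.le⟩,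
          fun _ => Or.inl fun w hw => (h9 w hw).2⟩
    · refine ⟨fun w hw => ?_, fun h => (h.ne h7).elim⟩
      by_contra h10
      exact h5 h7 (Or.inl ⟨hO, w, hw, h10⟩)

/-- Against any strategy of Odd, Even can play positionally. -/
theorem exists_play_of_positional (G : Game V) (ρ : G.Strategy .odd) (τ : V → V)
    (hτ : ∀ v ∈ G.VEven, G.E v (τ v)) (v₀ : V) :
    ∃ π, G.IsPlay π ∧ π 0 = v₀ ∧ Game.Compliant ρ π ∧ ∀ i, π i ∈ G.VEven → π (i + 1) = τ (π i) := by
  classical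
  let step : List V × V → List V × V := fun s =>
    (s.1 ++ [s.2], if h : s.2 ∈ G.VOdd then ρ.next s.1 ⟨s.2, h⟩ else τ s.2)
  let s : ℕ → List V × V := fun n => step^[n] ([], v₀)
  have hs : ∀ n, s (n + 1) = step (s n) := fun n => Function.iterate_succ_apply' _ _ _
  let π : ℕ → V := fun n => (s n).2
  have hhist : ∀ n, (s n).1 = (List.range n).map π := by
    intro n
    induction n with
    | zero => rfl
    | succ n ih => rw [hs, List.range_succ, List.map_append, ← ih]; rfl
  have hodd : ∀ i (h : π i ∈ G.VOdd), π (i + 1) = ρ.next ((List.range i).map π) ⟨π i, h⟩ := by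
    intro i h
    change (s (i + 1)).2 = _
    rw [hs, ← hhist]
    exact dif_pos h
  have heven : ∀ i, π i ∈ G.VEven → π (i + 1) = τ (π i) := by
    intro i h
    change (s (i + 1)).2 = _
    rw [hs]
    exact dif_neg (G.notMem_VOdd_of_mem_VEven h)
  refine ⟨π, fun i => ?_, rfl, hodd, heven⟩
  rcases G.mem_VEven_or_mem_VOdd (π i) with h | h
  · rw [heven i h]; exact hτ _ h
  · rw [hodd i h]; exact ρ.legal _ ⟨π i, h⟩

theorem winningRegion_odd_subset_Z [Finite V] (G : Game V) (l : ℕ) (hl : ∀ v, G.χ v ≤ l) :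
    G.winningRegion .odd ⊆ Z G l := by
  rintro v₀ ⟨ρ, hρ⟩
  by_contra hv₀
  obtain ⟨r, J, hr, h⟩ := exists_even_progress G l hl
  have hr' : ∀ i j v w, i ≤ j → r i v ≤ r i w → r j v ≤ r j w := fun i j v w hij h =>
    not_lt.1 fun h' => (hr i j w v hij h').not_ge h
  have hτ : ∀ v, ∃ w, v ∈ G.VEven → G.E v w ∧ (v ∉ Z G l → w ∉ Z G l ∧
      r (J v + 1) w ≤ r (J v + 1) v ∧ (G.χ v < J v → r (J v - 1) w < r (J v - 1) v)) := by
    intro v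
    by_cases hv : v ∈ Z G l
    · obtain ⟨w, hw⟩ := G.no_dead_end v
      exact ⟨w, fun _ => ⟨hw, fun h => (h hv).elim⟩⟩
    · by_cases hE : v ∈ G.VEven
      · obtain ⟨w, hw, h'⟩ := (h v hv).2.2.1 hE
        exact ⟨w, fun _ => ⟨hw, fun _ => h'⟩⟩
      · exact ⟨v, fun h => (hE h).elim⟩
  choose τ hτ using hτ
  obtain ⟨π, hplay, h0, hcomp, hpos⟩ :=
    exists_play_of_positional G ρ τ (fun v hv => (hτ v hv).1) v₀
  have hZ : ∀ t, π t ∉ Z G l := by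
    intro t
    induction t with
    | zero => rwa [h0]
    | succ t ih =>
      rcases G.mem_VEven_or_mem_VOdd (π t) with hv | hv
      · rw [hpos t hv]; exact ((hτ _ hv).2 ih).1
      · exact (((h _ ih).2.2.2 hv).1 _ (hplay t)).1
  have hle : ∀ t, r (J (π t) + 1) (π (t + 1)) ≤ r (J (π t) + 1) (π t) := by
    intro t
    rcases G.mem_VEven_or_mem_VOdd (π t) with hv | hv
    · rw [hpos t hv]; exact ((hτ _ hv).2 (hZ t)).2.1
    · exact (((h _ (hZ t)).2.2.2 hv).1 _ (hplay t)).2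
  obtain ⟨hfair, m, hm, hmodd⟩ := hρ π hplay h0 hcomp
  -- `u` is visited infinitely often, with the largest index `J u`
  obtain ⟨u, hu, hmax⟩ := (Set.toFinite {v | ∃ᶠ i in Filter.atTop, π i = v}).exists_maximalFor
    J _ ⟨_, (eventually_frequently_eq π).exists.choose_spec⟩
  have hmax' : ∀ v, (∃ᶠ i in Filter.atTop, π i = v) → J v ≤ J u := fun v hv =>
    (le_total (J v) (J u)).elim id fun h => hmax hv h
  have hmJ : m < J u := by
    obtain ⟨⟨v, hv, rfl⟩, -⟩ := hm
    obtain ⟨t, rfl⟩ := hv.exists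
    obtain ⟨h1, h2, -⟩ := h _ (hZ t)
    have h3 := hmax' _ hv
    rcases h2.lt_or_eq with h4 | h4
    · omega
    · rw [← h4] at h1
      exact (Nat.not_even_iff_odd.2 hmodd h1).elim
  obtain ⟨q, hq, hmin⟩ := (Set.toFinite {v | ∃ᶠ i in Filter.atTop, π i = v}).exists_minimalFor
    (r (J u - 1)) _ ⟨u, hu⟩
  have hmin' : ∀ v, (∃ᶠ i in Filter.atTop, π i = v) → r (J u - 1) q ≤ r (J u - 1) v :=
    fun v hv => (le_total (r (J u - 1) q) (r (J u - 1) v)).elim id fun h => hmin hv h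
  obtain ⟨T, hT⟩ := Filter.eventually_atTop.1 (eventually_frequently_eq π)
  have hχ : ∀ t ≥ T, G.χ (π t) < J u := fun t ht =>
    (hm.2 ⟨π t, hT t ht, rfl⟩).trans_lt hmJ
  have hne : ∀ t ≥ T, r (J u - 1) (π t) = r (J u - 1) q → J (π t) ≠ J u := by
    intro t ht heq hJ
    have hprog : (∃ w, (∃ᶠ i in Filter.atTop, π i = w) ∧ r (J u - 1) w < r (J u - 1) (π t)) := by
      have hχt := hJ ▸ hχ t ht
      rw [← hJ]
      rcases G.mem_VEven_or_mem_VOdd (π t) with hv | hv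
      · refine ⟨π (t + 1), hT _ (by omega), ?_⟩
        rw [hpos t hv]
        exact ((hτ _ hv).2 (hZ t)).2.2 hχt
      · rcases ((h _ (hZ t)).2.2.2 hv).2 hχt with h1 | ⟨w, hw, hlt⟩
        · exact ⟨π (t + 1), hT _ (by omega), h1 _ (hplay t)⟩
        · refine ⟨w, ?_, hlt⟩
          have := hfair _ w hw (hT t ht)
          rw [Filter.frequently_atTop] at this ⊢
          intro a
          obtain ⟨b, hb, -, h2⟩ := this a
          exact ⟨b + 1, by omega, h2⟩
    obtain ⟨w, hw, hlt⟩ := hprog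
    have := hmin' w hw
    omega
  obtain ⟨t₀, ht₀, hqt⟩ := Filter.frequently_atTop.1 hq T
  have hconst : ∀ t ≥ t₀, r (J u - 1) (π t) = r (J u - 1) q := by
    intro t ht
    induction t, ht using Nat.le_induction with
    | base => rw [hqt]
    | succ t ht ih =>
      refine le_antisymm ?_ (hmin' _ (hT _ (by omega)))
      have h1 := hmax' _ (hT t (by omega))
      have h2 := hne t (by omega) ih
      rw [← ih]
      obtain ⟨a, ha⟩ := (h _ (hZ t)).1
      obtain ⟨b, hb⟩ : Even (J u) := by
        obtain ⟨s, rfl⟩ := hu.exists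
        exact (h _ (hZ s)).1
      -- Two distinct even indices differ by at least 2, so `J (π t) + 1 ≤ J u - 1` and the weak
      -- inequality passes to the coarser rank.
      exact hr' _ _ _ _ (by omega) (hle t)
  obtain ⟨t, ht, rfl⟩ := Filter.frequently_atTop.1 hu t₀
  exact hne t (by omega) (hconst t ht) rfl

end OddFair

namespace OddFair

variable {V : Type u}

/-! ### On the fixpoint set, Odd wins -/

theorem Game.mem_cpre_odd_of_odd (G : Game V) {v : V} (hv : v ∈ G.VOdd) {S : Set V}
    (h : v ∈ G.cpre .odd S) : ∃ w, G.E v w ∧ w ∈ S :=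
  h.elim (fun h => h.2) fun h => (G.notMem_VOdd_of_mem_VEven h.1 hv).elim

theorem Game.mem_cpre_odd_of_even (G : Game V) {v : V} (hv : v ∈ G.VEven) {S : Set V}
    (h : v ∈ G.cpre .odd S) : ∀ w, G.E v w → w ∈ S :=
  h.elim (fun h => (G.notMem_VOdd_of_mem_VEven hv h.1).elim) fun h => h.2

/-- The data from which Odd's strategy on `Z` is built: `r` ranks the vertices, `b v` is the best
successor of `v`, and `d v` is the largest even index at which `b v` makes progress, or `0`. Live
edges at `v` cause no loss at the indices above `d v`. -/
theorem exists_odd_progress [Finite V] (G : Game V) (l : ℕ) (hl : ∀ v, G.χ v ≤ l) (hle : Even l) :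
    ∃ (r : ℕ → V → ℕ) (b : V → V) (d : V → ℕ), ∀ v ∈ Z G l,
      (v ∈ G.VEven → ∀ w, G.E v w → w ∈ Z G l ∧
        (∀ j, Even j → j ≤ l → G.χ v < j → r j w ≤ r j v) ∧
        (Even (G.χ v) → r (G.χ v) w < r (G.χ v) v)) ∧
      (v ∈ G.VOdd → (G.E v (b v) ∧ b v ∈ Z G l ∧
        (∀ j, Even j → j ≤ l → G.χ v < j → r j (b v) ≤ r j v) ∧
        (Even (G.χ v) → r (G.χ v) (b v) < r (G.χ v) v)) ∧
        (d v ≤ l ∧ Even (d v) ∧ (d v ≠ 0 → r (d v) (b v) < r (d v) v) ∧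
        (Even (G.χ v) → G.χ v ≤ d v)) ∧
        ∀ w, G.El v w → (d v < l → w ∈ Z G l) ∧
          ∀ j, Even j → j ≤ l → G.χ v < j → d v < j → r j w ≤ r j v) := by
  classical
  obtain ⟨r, hr, h⟩ := exists_rank_of_mem_Z G l
  have hr' : ∀ j v w, r 0 v ≤ r 0 w → r j v ≤ r j w := fun j v w h =>
    not_lt.1 fun h' => (hr 0 j w v (Nat.zero_le _) h').not_ge h
  have h2 : ∀ v, Even (G.χ v) → 2 ≤ G.χ v := fun v hv => by
    have := G.χ_pos v
    obtain ⟨a, ha⟩ := hv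
    omega
  -- Minimising the finest rank `r 0` minimises the rank at every index simultaneously, so one
  -- successor serves all `j`.
  have hb : ∀ v, ∃ b, (∃ w, G.E v w ∧ w ∈ Z G l) →
      (G.E v b ∧ b ∈ Z G l) ∧ ∀ w, G.E v w → w ∈ Z G l → r 0 b ≤ r 0 w := by
    intro v
    by_cases hv : ∃ w, G.E v w ∧ w ∈ Z G l
    · obtain ⟨b, hb, hmin⟩ := (Set.toFinite {w | G.E v w ∧ w ∈ Z G l}).exists_minimalFor
        (r 0) _ hv
      exact ⟨b, fun _ => ⟨hb, fun w hw hw' =>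
        (le_total (r 0 b) (r 0 w)).elim id fun h => hmin ⟨hw, hw'⟩ h⟩⟩
    · exact ⟨v, fun h => (hv h).elim⟩
  choose b hb using hb
  let P : V → ℕ → Prop := fun v j => Even j ∧ G.χ v ≤ j ∧ r j (b v) < r j v
  let d : V → ℕ := fun v => Nat.findGreatest (P v) l
  refine ⟨r, b, d, fun v hv => ⟨fun hE w hw => ?_, fun hO => ?_⟩⟩
  · have hlt : ∀ j, Even j → j ≤ l → G.χ v < j → w ∈ Z G l ∧ r j w ≤ r j v := by
      intro j hj hjl hχ
      have := G.χ_pos v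
      exact G.mem_cpre_odd_of_even hE ((h v hv j (by omega) hjl hj hχ.le).2 hχ).1 w hw
    have heq : Even (G.χ v) → w ∈ Z G l ∧ r (G.χ v) w < r (G.χ v) v := fun hχ =>
      G.mem_cpre_odd_of_even hE ((h v hv _ (h2 v hχ) (hl v) hχ le_rfl).1 rfl) w hw
    refine ⟨?_, fun j hj hjl hχ => (hlt j hj hjl hχ).2, fun hχ => (heq hχ).2⟩
    rcases (hl v).lt_or_eq with h3 | h3
    · exact (hlt l hle le_rfl h3).1
    · exact (heq (h3 ▸ hle)).1
  · have hlt : ∀ j, Even j → j ≤ l → G.χ v < j →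
        (∃ w, G.E v w ∧ w ∈ Z G l ∧ r j w ≤ r j v) ∧
        ((∀ w, G.El v w → w ∈ Z G l ∧ r j w ≤ r j v) ∨
          ∃ w, G.E v w ∧ w ∈ Z G l ∧ r j w < r j v) := by
      intro j hj hjl hχ
      have := G.χ_pos v
      have h3 := (h v hv j (by omega) hjl hj hχ.le).2 hχ
      refine ⟨G.mem_cpre_odd_of_odd hO h3.1, ?_⟩
      rcases h3.2 with (h4 | h4) | h4
      · exact (G.notMem_VOdd_of_mem_VEven h4 hO).elim
      · exact Or.inl h4.2
      · exact Or.inr h4.2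
    have heq : Even (G.χ v) → ∃ w, G.E v w ∧ w ∈ Z G l ∧ r (G.χ v) w < r (G.χ v) v := fun hχ =>
      G.mem_cpre_odd_of_odd hO ((h v hv _ (h2 v hχ) (hl v) hχ le_rfl).1 rfl)
    have hex : ∃ w, G.E v w ∧ w ∈ Z G l := by
      rcases (hl v).lt_or_eq with h3 | h3
      · obtain ⟨w, hw, hw', -⟩ := (hlt l hle le_rfl h3).1
        exact ⟨w, hw, hw'⟩
      · obtain ⟨w, hw, hw', -⟩ := heq (h3 ▸ hle)
        exact ⟨w, hw, hw'⟩
    obtain ⟨⟨hbE, hbZ⟩, hmin⟩ := hb v hex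
    have hmin' : ∀ j w, G.E v w → w ∈ Z G l → r j (b v) ≤ r j w := fun j w hw hw' =>
      hr' j _ _ (hmin w hw hw')
    have hbeq : Even (G.χ v) → r (G.χ v) (b v) < r (G.χ v) v := fun hχ => by
      obtain ⟨w, hw, hw', h3⟩ := heq hχ
      exact (hmin' _ w hw hw').trans_lt h3
    have hd : d v ≠ 0 → P v (d v) := fun h3 => Nat.findGreatest_of_ne_zero rfl h3
    -- By maximality of `d v`, no successor in `Z` makes progress at `j`, so `Npre` must hold
    -- through its live-edge clause.
    have hlive : ∀ j, Even j → j ≤ l → G.χ v < j → d v < j →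
        ∀ w, G.El v w → w ∈ Z G l ∧ r j w ≤ r j v := by
      intro j hj hjl hχ hdj
      rcases (hlt j hj hjl hχ).2 with h3 | ⟨w, hw, hw', h3⟩
      · exact h3
      · exact (Nat.findGreatest_is_greatest hdj hjl
          ⟨hj, hχ.le, (hmin' _ w hw hw').trans_lt h3⟩).elim
    have hχd : Even (G.χ v) → G.χ v ≤ d v := fun hχ =>
      Nat.le_findGreatest (hl v) ⟨hχ, le_rfl, hbeq hχ⟩
    refine ⟨⟨hbE, hbZ, fun j hj hjl hχ => ?_, hbeq⟩, ⟨Nat.findGreatest_le _, ?_,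
      fun h3 => (hd h3).2.2, hχd⟩, fun w hw => ⟨fun h3 => ?_,
        fun j hj hjl hχ hdj => (hlive j hj hjl hχ hdj w hw).2⟩⟩
    · obtain ⟨w, hw, hw', h3⟩ := (hlt j hj hjl hχ).1
      exact (hmin' _ w hw hw').trans h3
    · by_cases h3 : d v = 0
      · rw [h3]; exact Even.zero
      · exact (hd h3).1
    · have h4 : G.χ v < l := (hl v).lt_of_ne fun h4 => by
        have := hχd (h4 ▸ hle)
        omega
      exact (hlive l hle le_rfl h4 h3 w hw).1

/-! ### Memory for serving live edges in turn -/

/-- An enumeration of a set in which each element occurs infinitely often, with a default value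
for the empty set. -/
theorem exists_enumeration [Finite V] (S : Set V) (a : V) : ∃ f : ℕ → V,
    (∀ n, f n ∈ S ∨ f n = a) ∧ ∀ w ∈ S, ∀ n, ∃ k ≥ n, f k = w := by
  rcases S.eq_empty_or_nonempty with rfl | hne
  · exact ⟨fun _ => a, fun _ => Or.inr rfl, fun w hw => hw.elim⟩
  · obtain ⟨g, hg⟩ := S.toFinite.countable.exists_eq_range hne
    refine ⟨fun n => g n.unpair.1, fun n => Or.inl (hg ▸ ⟨_, rfl⟩), fun w hw n => ?_⟩
    obtain ⟨m, rfl⟩ := hg ▸ hw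
    exact ⟨Nat.pair m n, Nat.right_le_pair m n, by simp⟩

/-- Along the play `π`, the set `F t` consists of the vertices `v` for which a vertex `x` with
`R v x` was visited since the last visit to `v` before time `t`, and `c t v` counts the visits to
`v` before time `t` at which `v` was in that set. -/
structure IsMemory (R : V → V → Prop) (π : ℕ → V) (F : ℕ → Set V) (c : ℕ → V → ℕ) : Prop where
  zero : ∀ v, v ∈ F 0 ↔ R v (π 0)
  succ : ∀ t v, v ∈ F (t + 1) ↔ (v ∈ F t ∧ v ≠ π t) ∨ R v (π (t + 1))
  count_eq : ∀ t v, ¬ (v = π t ∧ v ∈ F t) → c (t + 1) v = c t v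
  count_succ : ∀ t, π t ∈ F t → c (t + 1) (π t) = c t (π t) + 1

namespace IsMemory

variable {R : V → V → Prop} {π : ℕ → V} {F : ℕ → Set V} {c : ℕ → V → ℕ}

theorem exists_rel (h : IsMemory R π F c) {t : ℕ} {v : V} (hv : v ∈ F t) : ∃ s, R v (π s) := by
  induction t with
  | zero => exact ⟨0, (h.zero v).1 hv⟩
  | succ t ih =>
    rcases (h.succ t v).1 hv with h1 | h1
    · exact ih h1.1
    · exact ⟨_, h1⟩

/-- A visit to `u` removes it from the memory, and once `R u` has ceased nothing puts it back. -/
theorem eventually_notMem (h : IsMemory R π F c) {u : V}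
    (hR : ∀ᶠ t in Filter.atTop, ¬ R u (π t)) : ∀ᶠ t in Filter.atTop, π t = u → u ∉ F t := by
  by_cases hu : ∃ᶠ t in Filter.atTop, π t = u
  · obtain ⟨T, hT⟩ := Filter.eventually_atTop.1 hR
    obtain ⟨s, hs, rfl⟩ := Filter.frequently_atTop.1 hu T
    filter_upwards [Filter.eventually_ge_atTop (s + 1)] with t ht hπt
    clear hπt
    induction t, ht using Nat.le_induction with
    | base =>
      rw [h.succ]
      rintro (h1 | h1)
      · exact h1.2 rfl
      · exact hT _ (by omega) h1
    | succ t ht ih =>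
      rw [h.succ]
      rintro (h1 | h1)
      · exact ih h1.1
      · exact hT _ (by omega) h1
  · filter_upwards [Filter.not_frequently.1 hu] with t h1 h2 using (h1 h2).elim

theorem exists_mem (h : IsMemory R π F c) {u : V} (hR : ∃ᶠ t in Filter.atTop, R u (π t))
    (hu : ∃ᶠ t in Filter.atTop, π t = u) (T : ℕ) : ∃ t ≥ T, π t = u ∧ u ∈ F t := by
  obtain ⟨s, hs, hRs⟩ := Filter.frequently_atTop.1 hR T
  by_contra! hc
  have hmem : ∀ t ≥ s, u ∈ F t := by
    intro t ht
    induction t, ht using Nat.le_induction with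
    | base =>
      cases s with
      | zero => exact (h.zero u).2 hRs
      | succ s => exact (h.succ s u).2 (Or.inr hRs)
    | succ t ht ih => exact (h.succ t u).2 (Or.inl ⟨ih, fun h1 => hc t (by omega) h1.symm ih⟩)
  obtain ⟨t, ht, hut⟩ := Filter.frequently_atTop.1 hu s
  exact hc t (by omega) hut (hmem t ht)

theorem exists_mem_count_eq (h : IsMemory R π F c) {u : V}
    (hR : ∃ᶠ t in Filter.atTop, R u (π t)) (hu : ∃ᶠ t in Filter.atTop, π t = u) (T : ℕ) :
    ∃ t ≥ T, π t = u ∧ u ∈ F t ∧ c t u = c T u := by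
  classical
  have hex := h.exists_mem hR hu T
  obtain ⟨h1, h2, h3⟩ := Nat.find_spec hex
  have hc : ∀ t ≥ T, t ≤ Nat.find hex → c t u = c T u := by
    intro t ht
    induction t, ht using Nat.le_induction with
    | base => exact fun _ => rfl
    | succ t ht ih =>
      intro hlt
      rw [h.count_eq, ih (by omega)]
      rintro ⟨h4, h5⟩
      exact Nat.find_min hex (m := t) (by omega) ⟨ht, h4.symm, h5⟩
  exact ⟨_, h1, h2, h3, hc _ h1 le_rfl⟩

/-- The counter grows by exactly one at each marked visit, and these recur, so no value is skipped.
-/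
theorem exists_count_eq (h : IsMemory R π F c) {u : V} (hR : ∃ᶠ t in Filter.atTop, R u (π t))
    (hu : ∃ᶠ t in Filter.atTop, π t = u) (T n : ℕ) (hn : c T u ≤ n) :
    ∃ t ≥ T, π t = u ∧ u ∈ F t ∧ c t u = n := by
  obtain ⟨k, rfl⟩ := Nat.exists_eq_add_of_le hn
  clear hn
  induction k generalizing T with
  | zero => exact h.exists_mem_count_eq hR hu T
  | succ k ih =>
    obtain ⟨t, ht, rfl, h2, h3⟩ := h.exists_mem_count_eq hR hu T
    have h4 := h.count_succ t h2
    obtain ⟨t', ht', h5⟩ := ih (t + 1)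
    exact ⟨t', by omega, h5.1, h5.2.1, by omega⟩

/-- If the vertex `u` is followed by `f (c t u)` whenever it is in the memory, and `f` takes the
value `w` infinitely often, then the edge from `u` to `w` is taken infinitely often. -/
theorem frequently_edge (h : IsMemory R π F c) {u w : V} {f : ℕ → V}
    (hR : ∃ᶠ t in Filter.atTop, R u (π t)) (hu : ∃ᶠ t in Filter.atTop, π t = u)
    (hπ : ∀ t, π t = u → u ∈ F t → π (t + 1) = f (c t u)) (hf : ∀ n, ∃ k ≥ n, f k = w) :
    ∃ᶠ t in Filter.atTop, π t = u ∧ π (t + 1) = w := by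
  refine Filter.frequently_atTop.2 fun T => ?_
  obtain ⟨k, hk, hkw⟩ := hf (c T u)
  obtain ⟨t, ht, h1, h2, h3⟩ := h.exists_count_eq hR hu T k hk
  exact ⟨t, ht, h1, by rw [hπ t h1 h2, h3, hkw]⟩

end IsMemory

/-- Odd can choose between the successors `b v` and `f v n` by means of the memory of
`IsMemory`. -/
theorem exists_memory_strategy (G : Game V) (b : V → V) (f : V → ℕ → V) (R : V → V → Prop)
    (hb : ∀ v ∈ G.VOdd, G.E v (b v)) (hf : ∀ v ∈ G.VOdd, ∀ n, G.E v (f v n)) :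
    ∃ ρ : G.Strategy .odd, ∀ π, Game.Compliant ρ π → ∃ F c, IsMemory R π F c ∧
      ∀ t, π t ∈ G.VOdd → (π t ∈ F t → π (t + 1) = f (π t) (c t (π t))) ∧
        (π t ∉ F t → π (t + 1) = b (π t)) := by
  classical
  let add : Set V → V → Set V := fun A x => {v | v ∈ A ∨ R v x}
  let step : Set V × (V → ℕ) → V → Set V × (V → ℕ) := fun s x =>
    ({v | v ∈ add s.1 x ∧ v ≠ x}, fun v => if v = x ∧ v ∈ add s.1 x then s.2 v + 1 else s.2 v)
  let mem : List V → Set V × (V → ℕ) := List.foldl step (∅, fun _ => 0)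
  let ρ : G.Strategy .odd :=
    -- The current vertex is added to the memory before the decision, so its own priority counts.
    { next := fun u v => if (v : V) ∈ add (mem u).1 v then f v ((mem u).2 v) else b v
      legal := fun u v => by
        split_ifs
        · exact hf v v.2 _
        · exact hb v v.2 }
  refine ⟨ρ, fun π hπ => ?_⟩
  let s : ℕ → Set V × (V → ℕ) := fun t => mem ((List.range t).map π)
  have hs : ∀ t, s (t + 1) = step (s t) (π t) := by
    intro t
    simp only [s, mem, List.range_succ, List.map_append, List.foldl_append, List.map_cons,
      List.map_nil, List.foldl_cons, List.foldl_nil]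
  refine ⟨fun t => add (s t).1 (π t), fun t => (s t).2, ⟨fun v => ?_, fun t v => ?_,
    fun t v h => ?_, fun t h => ?_⟩, fun t ht => ?_⟩
  · exact ⟨fun h => h.elim (fun h => h.elim) id, Or.inr⟩
  · rw [hs]; exact Iff.rfl
  · rw [hs]; exact if_neg h
  · rw [hs]; exact if_pos ⟨rfl, h⟩
  · have := hπ t ht
    exact ⟨fun h => this.trans (if_pos h), fun h => this.trans (if_neg h)⟩

end OddFair

/-! ### Odd's memory strategy wins on the fixpoint set -/

namespace OddFair

variable {V : Type u}

theorem Z_subset_winningRegion_odd [Finite V] (G : Game V) (l : ℕ) (hl : ∀ v, G.χ v ≤ l)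
    (hle : Even l) : Z G l ⊆ G.winningRegion .odd := by
  obtain ⟨r, b₀, d, h⟩ := exists_odd_progress G l hl hle
  choose s hs using G.no_dead_end
  classical
  let b : V → V := fun v => if v ∈ Z G l then b₀ v else s v
  have hbE : ∀ v ∈ G.VOdd, G.E v (b v) := fun v hv => by
    by_cases hZ : v ∈ Z G l
    · simpa [b, hZ] using ((h v hZ).2 hv).1.1
    · simpa [b, hZ] using hs v
  have hb : ∀ v ∈ Z G l, b v = b₀ v := fun v hv => if_pos hv
  choose f hf hf' using fun v => exists_enumeration {w | G.El v w} (b v)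
  obtain ⟨ρ, hρ⟩ := exists_memory_strategy G b f (fun v x => d v < G.χ x) hbE fun v hv n =>
    (hf v n).elim (fun h => G.El_sub _ _ h) fun h => h ▸ hbE v hv
  refine fun v₀ hv₀ => ⟨ρ, fun π hplay h0 hcomp => ?_⟩
  obtain ⟨F, c, hF, hmove⟩ := hρ π hcomp
  -- at a vertex of Odd, the play takes the best edge, or a live edge after a higher priority
  have hcases : ∀ t, π t ∈ G.VOdd → π (t + 1) = b (π t) ∨
      (π t ∈ F t ∧ G.El (π t) (π (t + 1))) := by
    intro t ht
    by_cases hFt : π t ∈ F t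
    · have h1 := (hmove t ht).1 hFt
      rcases hf (π t) (c t (π t)) with h2 | h2
      · exact Or.inr ⟨hFt, h1 ▸ h2⟩
      · exact Or.inl (h1.trans h2)
    · exact Or.inl ((hmove t ht).2 hFt)
  have hZ : ∀ t, π t ∈ Z G l := by
    intro t
    induction t with
    | zero => rwa [h0]
    | succ t ih =>
      rcases G.mem_VEven_or_mem_VOdd (π t) with hv | hv
      · exact ((h _ ih).1 hv _ (hplay t)).1
      · rcases hcases t hv with h1 | ⟨h1, h2⟩
        · rw [h1, hb _ ih]; exact ((h _ ih).2 hv).1.2.1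
        · obtain ⟨x, hx⟩ := hF.exists_rel h1
          exact (((h _ ih).2 hv).2.2 _ h2).1 (hx.trans_le (hl _))
  obtain ⟨m, hm, hχm⟩ := G.exists_isGreatest_infPriorities π
  -- Priorities above `m` eventually vanish, so vertices with `d u ≥ m` stop being marked and only
  -- the best edge is played there.
  have hrare : ∀ᶠ t in Filter.atTop, ∀ u, m ≤ d u → π t = u → u ∉ F t := by
    refine Filter.eventually_all.2 fun u => ?_
    by_cases hu : m ≤ d u
    · have : ∀ᶠ t in Filter.atTop, ¬ d u < G.χ (π t) := by
        filter_upwards [hχm] with t ht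
        omega
      filter_upwards [hF.eventually_notMem this] with t ht _ using ht
    · simp [hu]
  -- no rank at an even index from `m` on decreases infinitely often
  have key : ∀ j, Even j → m ≤ j → j ≤ l → ¬ ∃ᶠ t in Filter.atTop,
      G.χ (π t) = j ∨ (π t ∈ G.VOdd ∧ d (π t) = j ∧ j ≠ 0) := by
    intro j hj hmj hjl hfreq
    have hev : ∀ᶠ t in Filter.atTop, r j (π (t + 1)) ≤ r j (π t) ∧
        ((G.χ (π t) = j ∨ (π t ∈ G.VOdd ∧ d (π t) = j ∧ j ≠ 0)) →
          r j (π (t + 1)) < r j (π t)) := by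
      filter_upwards [hχm, hrare] with t h1 h2
      have h3 := h1.trans hmj
      rcases G.mem_VEven_or_mem_VOdd (π t) with hv | hv
      · obtain ⟨-, h4, h5⟩ := (h _ (hZ t)).1 hv _ (hplay t)
        rcases h3.lt_or_eq with h6 | h6
        · refine ⟨h4 j hj hjl h6, ?_⟩
          rintro (h7 | ⟨h7, -⟩)
          · omega
          · exact (G.notMem_VOdd_of_mem_VEven hv h7).elim
        · subst h6
          exact ⟨(h5 hj).le, fun _ => h5 hj⟩
      · obtain ⟨⟨-, -, h4, h5⟩, ⟨-, -, h6, h7⟩, h8⟩ := (h _ (hZ t)).2 hv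
        rcases hcases t hv with h9 | ⟨h9, h10⟩
        · rw [h9, hb _ (hZ t)]
          have hlt : (G.χ (π t) = j ∨ (π t ∈ G.VOdd ∧ d (π t) = j ∧ j ≠ 0)) →
              r j (b₀ (π t)) < r j (π t) := by
            rintro (h11 | ⟨-, h11, h12⟩)
            · subst h11; exact h5 hj
            · subst h11; exact h6 h12
          refine ⟨?_, hlt⟩
          rcases h3.lt_or_eq with h11 | h11
          · exact h4 j hj hjl h11
          · exact (hlt (Or.inl h11)).le
        · have h11 : d (π t) < m := by
            by_contra h11
            exact h2 _ (by omega) rfl h9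
          have h12 : G.χ (π t) ≠ j := by
            rintro rfl
            have := h7 hj
            omega
          refine ⟨(h8 _ h10).2 j hj hjl (by omega) (by omega), ?_⟩
          rintro (h13 | ⟨-, h13, -⟩) <;> omega
    refine not_frequently_lt_of_eventually_le (fun t => r j (π t)) (hev.mono fun t h => h.1) ?_
    exact (hfreq.and_eventually hev).mono fun t h => h.2.2 h.1
  obtain ⟨⟨x, hx, hxm⟩, hmax⟩ := id hm
  have hfreq : ∃ᶠ t in Filter.atTop, G.χ (π t) = m := hx.mono fun t ht => ht ▸ hxm
  have hmodd : Odd m := by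
    by_contra hm'
    exact key m (Nat.not_odd_iff_even.1 hm') le_rfl (hxm ▸ hl x) (hfreq.mono fun _ => Or.inl)
  refine ⟨fun v w hvw hv => ?_, m, hm, hmodd⟩
  have hvO := G.El_odd _ _ hvw
  -- Otherwise `v` would recur with `d v` even and at least `m`, which `key` forbids at `j = d v`.
  have hdm : d v < m := by
    by_contra hdm
    obtain ⟨t, ht⟩ := hv.exists
    have hd := ((h v (ht ▸ hZ t)).2 hvO).2.1
    refine key (d v) hd.2.1 (by omega) hd.1 (hv.mono fun t ht => Or.inr ?_)
    subst ht
    exact ⟨hvO, rfl, by have := hmodd.pos; omega⟩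
  refine hF.frequently_edge (f := f v) (hfreq.mono fun t ht => ht ▸ hdm) hv ?_ (hf' v w hvw)
  rintro t rfl ht
  exact (hmove t hvO).1 ht

end OddFair

/-! ### Correctness and cost of the formula -/

theorem mainTheorem4 (l : ℕ) :
    (∀ (V : Type u) [Finite V] (G : OddFair.Game V), G.IsLeastEvenUpperBound l →
      OddFair.Z G l = G.winningRegion .odd) ∧
    ∃ c : ℕ, ∀ (V : Type u) [Finite V] (G : OddFair.Game V), G.IsLeastEvenUpperBound l →
      ((OddFair.Formula.oddFormula G l).run G (fun _ => ∅)).1 = G.winningRegion .odd ∧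
      ((OddFair.Formula.oddFormula G l).run G (fun _ => ∅)).2 ≤ c * Nat.card V ^ (l + 1) := by
  have hZ : ∀ (V : Type u) [Finite V] (G : OddFair.Game V), G.IsLeastEvenUpperBound l →
      OddFair.Z G l = G.winningRegion .odd := fun V _ G ⟨hle, _, hC⟩ => by
    have hl : ∀ v, G.χ v ≤ l := fun v => by
      by_contra! h
      have h' : v ∈ G.C (G.χ v) := rfl
      rw [hC _ h] at h'
      exact h'
    exact subset_antisymm (OddFair.Z_subset_winningRegion_odd G l hl hle)
      (OddFair.winningRegion_odd_subset_Z G l hl)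
  obtain ⟨c, hc⟩ := OddFair.Formula.run_snd_close_le.{u} ((2 * (l + 1) + 40) * (l + 1) + 1) l
  refine ⟨hZ, c, fun V _ G hG => ⟨?_, ?_⟩⟩
  · rw [← hZ V G hG, OddFair.Formula.run_fst]; rfl
  · have : Nonempty V := ⟨hG.2.1.some⟩
    have h := hc V G (OddFair.Formula.body G l)
      (fun e => OddFair.Formula.run_snd_body_le G l e) (fun _ => ∅)
    -- The argument gives the exponent `l`; `V` being nonempty, it may be raised to `l + 1`.
    exact h.trans (Nat.mul_le_mul_left _ (Nat.pow_le_pow_right Nat.card_pos (Nat.le_succ l)))
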